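/- Let $N \ge 1$ be an integer and let $p > N$ be real. There is a constant $C > 0$, depending only on $p$ and $N$, such that the following holds. Let $\Omega \subset \mathbb{R}^N$ be an open set, let $w \in L^1(\Omega)$ with $w \ge 0$ a.e. in $\Omega$, and let $u \in W_0^{1,p}(\Omega)$ (the closure of $C_c^\infty(\Omega)$ in $W^{1,p}(\Omega)$) be a nontrivial (that is, not a.e. zero in $\Omega$) weak solution of $$-\Delta_p u = w|u|^{p-2}u \ \text{ in } \Omega, \qquad u = 0 \ \text{ on } \partial\Omega,$$ where $\Delta_p u = \operatorname{div}(|\nabla u|^{p-2}\nabla u)$, meaning that $$\int_\Omega |\nabla u|^{p-2}\nabla u\cdot\nabla\varphi\,dx = \int_\Omega w|u|^{p-2}u\,\varphi\,dx \qquad \text{for all } \varphi \in W_0^{1,p}(\Omega).$$ Then $$\frac{C}{r_\Omega^{\,p-N}} \le \|w\|_{L^1(\Omega)},$$ where $r_\Omega = \sup_{x\in\Omega} \operatorname{dist}(x, \mathbb{R}^N\setminus\Omega) \in (0,\infty]$ is the inner radius of $\Omega$; when $r_\Omega = \infty$ the left-hand side is read as $0$. -/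

import Mathlib

open MeasureTheory Filter Topology TopologicalSpace
open scoped ENNReal Distributions

/-- The inner radius `sup_{x ∈ Ω} dist(x, Ωᶜ)` of `Ω`, as an element of `[0, ∞]`
(it is `∞` when `Ω` contains arbitrarily large balls, in particular for the whole space). -/
noncomputable def innerRadius {N : ℕ} (Ω : Opens (EuclideanSpace ℝ (Fin N))) : ℝ≥0∞ :=
  ⨆ x ∈ Ω, Metric.infEDist x (Ω : Set (EuclideanSpace ℝ (Fin N)))ᶜ

/-- `G` is a weak (distributional) gradient of `u` in `Ω`:
`∫_Ω u ∇φ = - ∫_Ω φ G` for every smooth compactly supported `φ` in `Ω`. -/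
structure IsWeakGradient {N : ℕ} (Ω : Opens (EuclideanSpace ℝ (Fin N)))
    (u : EuclideanSpace ℝ (Fin N) → ℝ)
    (G : EuclideanSpace ℝ (Fin N) → EuclideanSpace ℝ (Fin N)) : Prop where
  locallyIntegrableOn_fun : LocallyIntegrableOn u (Ω : Set (EuclideanSpace ℝ (Fin N)))
  locallyIntegrableOn_grad : LocallyIntegrableOn G (Ω : Set (EuclideanSpace ℝ (Fin N)))
  integral_eq : ∀ φ : 𝓓(Ω, ℝ),
    ∫ x in (Ω : Set (EuclideanSpace ℝ (Fin N))), u x • gradient φ x =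
      - ∫ x in (Ω : Set (EuclideanSpace ℝ (Fin N))), φ x • G x

/-- `u` belongs to the Sobolev space `W^{1,p}(Ω)` and `G` is (a representative of) its
weak gradient. -/
structure MemW1p {N : ℕ} (Ω : Opens (EuclideanSpace ℝ (Fin N))) (p : ℝ)
    (u : EuclideanSpace ℝ (Fin N) → ℝ)
    (G : EuclideanSpace ℝ (Fin N) → EuclideanSpace ℝ (Fin N)) : Prop where
  memLp_fun : MemLp u (ENNReal.ofReal p) (volume.restrict Ω)
  memLp_grad : MemLp G (ENNReal.ofReal p) (volume.restrict Ω)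
  isWeakGradient : IsWeakGradient Ω u G

/-- `u` belongs to `W_0^{1,p}(Ω)`, the closure of `C_c^∞(Ω)` in `W^{1,p}(Ω)`, and `G` is
(a representative of) its weak gradient. -/
structure MemW1p₀ {N : ℕ} (Ω : Opens (EuclideanSpace ℝ (Fin N))) (p : ℝ)
    (u : EuclideanSpace ℝ (Fin N) → ℝ)
    (G : EuclideanSpace ℝ (Fin N) → EuclideanSpace ℝ (Fin N)) : Prop where
  memW1p : MemW1p Ω p u G
  exists_approx : ∃ φ : ℕ → 𝓓(Ω, ℝ),
    Tendsto (fun n => eLpNorm (fun x => φ n x - u x) (ENNReal.ofReal p) (volume.restrict Ω))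
      atTop (𝓝 0) ∧
    Tendsto (fun n => eLpNorm (fun x => gradient (φ n) x - G x) (ENNReal.ofReal p)
      (volume.restrict Ω)) atTop (𝓝 0)

/-- `u` is a weak solution in `W_0^{1,p}(Ω)` of `-Δ_p u = w |u|^{p-2} u` in `Ω`, `u = 0` on `∂Ω`:
`∫_Ω |∇u|^{p-2} ∇u · ∇φ = ∫_Ω w |u|^{p-2} u φ` for all `φ ∈ W_0^{1,p}(Ω)`.
The weak gradients `G` of `u` and `H` of `φ` are unique almost everywhere in `Ω`. -/
def IsWeakSolution {N : ℕ} (Ω : Opens (EuclideanSpace ℝ (Fin N))) (p : ℝ)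
    (w u : EuclideanSpace ℝ (Fin N) → ℝ) : Prop :=
  ∃ G : EuclideanSpace ℝ (Fin N) → EuclideanSpace ℝ (Fin N), MemW1p₀ Ω p u G ∧
    ∀ (φ : EuclideanSpace ℝ (Fin N) → ℝ)
      (H : EuclideanSpace ℝ (Fin N) → EuclideanSpace ℝ (Fin N)), MemW1p₀ Ω p φ H →
      ∫ x in (Ω : Set (EuclideanSpace ℝ (Fin N))), ‖G x‖ ^ (p - 2) * inner ℝ (G x) (H x) =
        ∫ x in (Ω : Set (EuclideanSpace ℝ (Fin N))), w x * (|u x| ^ (p - 2) * u x * φ x)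

/-! Test the equation with `u` itself: `∫ |∇u|^p = ∫ w |u|^p ≤ ‖w‖₁ (sup |u|)^p`. It remains to
bound `sup |u|` by `K r_Ω^(1-N/p) ‖∇u‖_p`, after which the nonzero finite factor `‖∇u‖_p^p` cancels.

The sup bound is Morrey's inequality (`enorm_sub_center_le_morrey`): a test function, extended by
zero, vanishes at a point of the complement within distance `r_Ω` of `x`, so its value at `x` is an
oscillation at scale `r_Ω`. Density carries this to `W_0^{1,p}` (`MemW1p₀.ae_enorm_le`). -/

section Dilation

variable {E : Type*} [NormedAddCommGroup E] [NormedSpace ℝ E] [FiniteDimensional ℝ E]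
  [MeasurableSpace E] [BorelSpace E] (μ : Measure E) [μ.IsAddHaarMeasure]

theorem lintegral_comp_homothety (g : E → ℝ≥0∞) (hg : Measurable g) (x : E) {t : ℝ} (ht : 0 < t) :
    ∫⁻ z, g (x + t • (z - x)) ∂μ
      = ENNReal.ofReal ((t ^ Module.finrank ℝ E)⁻¹) * ∫⁻ z, g z ∂μ := by
  have h1 : ∫⁻ z, g (x + t • (z - x)) ∂μ = ∫⁻ z, g (x + t • z) ∂μ :=
    lintegral_sub_right_eq_self (fun z => g (x + t • z)) x
  have h2 : ∫⁻ z, g (x + t • z) ∂μ = ∫⁻ y, g (x + y) ∂(Measure.map (fun z => t • z) μ) := by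
    exact (lintegral_map (hg.comp (measurable_const_add x)) (measurable_const_smul t)).symm
  rw [h1, h2, Measure.map_addHaar_smul μ ht.ne', lintegral_smul_measure,
    lintegral_add_left_eq_self, abs_of_pos (by positivity), smul_eq_mul]

theorem eLpNorm_comp_homothety {F : Type*} [NormedAddCommGroup F] (g : E → F) (hg : Continuous g)
    {p : ℝ} (hp : 0 < p) (x : E) {t : ℝ} (ht : 0 < t) :
    eLpNorm (fun z => g (x + t • (z - x))) (ENNReal.ofReal p) μ
      = ENNReal.ofReal (t ^ (-(Module.finrank ℝ E : ℝ) / p)) * eLpNorm g (ENNReal.ofReal p) μ := by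
  have hp0 : ENNReal.ofReal p ≠ 0 := by simpa using hp
  rw [eLpNorm_eq_lintegral_rpow_enorm_toReal hp0 ENNReal.ofReal_ne_top,
    eLpNorm_eq_lintegral_rpow_enorm_toReal hp0 ENNReal.ofReal_ne_top,
    ENNReal.toReal_ofReal hp.le,
    lintegral_comp_homothety μ (fun z => ‖g z‖ₑ ^ p) (hg.enorm.measurable.pow_const p) x ht,
    ENNReal.mul_rpow_of_nonneg _ _ (by positivity),
    ENNReal.ofReal_rpow_of_pos (by positivity)]
  congr 2
  rw [← Real.rpow_natCast, ← Real.rpow_neg ht.le, ← Real.rpow_mul ht.le]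
  congr 1
  ring

/-- Hölder on `s`, then scaling of the norm over the whole space. The power of `t` is integrable at
`0` exactly when `p` exceeds the dimension. -/
theorem setLIntegral_comp_homothety_le {F : Type*} [NormedAddCommGroup F] (g : E → F)
    (hg : Continuous g) {p : ℝ} (hp : 1 ≤ p) (s : Set E) (x : E) {t : ℝ} (ht : 0 < t) :
    ∫⁻ z in s, ‖g (x + t • (z - x))‖ₑ ∂μ
      ≤ ENNReal.ofReal (t ^ (-(Module.finrank ℝ E : ℝ) / p)) *
        (eLpNorm g (ENNReal.ofReal p) μ * μ s ^ (1 - 1 / p)) := by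
  have hp0 : 0 < p := by linarith
  have hc : Continuous fun z => g (x + t • (z - x)) := by fun_prop
  calc ∫⁻ z in s, ‖g (x + t • (z - x))‖ₑ ∂μ
      = eLpNorm (fun z => g (x + t • (z - x))) 1 (μ.restrict s) :=
        eLpNorm_one_eq_lintegral_enorm.symm
    _ ≤ eLpNorm (fun z => g (x + t • (z - x))) (ENNReal.ofReal p) (μ.restrict s)
          * μ s ^ (1 - 1 / p) := by
        have := eLpNorm_le_eLpNorm_mul_rpow_measure_univ (μ := μ.restrict s)
          (ENNReal.one_le_ofReal.2 hp) hc.aestronglyMeasurable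
        simpa [ENNReal.toReal_ofReal hp0.le] using this
    _ ≤ eLpNorm (fun z => g (x + t • (z - x))) (ENNReal.ofReal p) μ * μ s ^ (1 - 1 / p) := by
        gcongr
        exact Measure.restrict_le_self
    _ = _ := by rw [eLpNorm_comp_homothety μ g hg hp0 x ht, mul_assoc]

end Dilation

theorem setLIntegral_rpow_Ioc_zero_one {a : ℝ} (ha : -1 < a) :
    ∫⁻ t in Set.Ioc (0 : ℝ) 1, ENNReal.ofReal (t ^ a) = ENNReal.ofReal (1 / (a + 1)) := by
  have hi := intervalIntegral.intervalIntegrable_rpow' (a := 0) (b := 1) ha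
  rw [intervalIntegrable_iff_integrableOn_Ioc_of_le zero_le_one] at hi
  rw [← ofReal_integral_eq_lintegral_ofReal hi
      (ae_restrict_of_forall_mem measurableSet_Ioc fun t ht => Real.rpow_nonneg ht.1.le a),
    ← intervalIntegral.integral_of_le zero_le_one, integral_rpow (Or.inl ha), Real.one_rpow,
    Real.zero_rpow (by linarith), sub_zero]

/-! ### Morrey's inequality for `C¹` functions -/

section Morrey

variable {E : Type*} [NormedAddCommGroup E] [NormedSpace ℝ E]

theorem enorm_sub_le_lintegral_fderiv {f : E → ℝ} (hf : ContDiff ℝ 1 f) (x z : E) :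
    ‖f z - f x‖ₑ
      ≤ ‖z - x‖ₑ * ∫⁻ t in Set.Ioc (0 : ℝ) 1, ‖fderiv ℝ f (x + t • (z - x))‖ₑ := by
  have hcont : Continuous (fderiv ℝ f) := hf.continuous_fderiv one_ne_zero
  have hd : ∀ t : ℝ, HasDerivAt (fun t : ℝ => f (x + t • (z - x)))
      (fderiv ℝ f (x + t • (z - x)) (z - x)) t := fun t => by
    have h1 : HasDerivAt (fun t : ℝ => x + t • (z - x)) (z - x) t := by
      simpa using ((hasDerivAt_id t).smul_const (z - x)).const_add x
    exact ((hf.differentiable one_ne_zero _).hasFDerivAt).comp_hasDerivAt t h1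
  have hftc : ∫ t in (0 : ℝ)..1, fderiv ℝ f (x + t • (z - x)) (z - x) = f z - f x := by
    rw [intervalIntegral.integral_eq_sub_of_hasDerivAt (fun t _ => hd t)]
    · simp
    · exact Continuous.intervalIntegrable (by fun_prop) _ _
  rw [← hftc, intervalIntegral.integral_of_le zero_le_one,
    ← lintegral_const_mul' _ _ enorm_ne_top]
  refine (enorm_integral_le_lintegral_enorm _).trans (lintegral_mono fun t => ?_)
  rw [mul_comm]
  exact ContinuousLinearMap.le_opENorm _ _

/-- The constant in Morrey's inequality on the unit ball. -/
noncomputable def morreyConst [MeasurableSpace E] (μ : Measure E) (p : ℝ) : ℝ≥0∞ :=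
  4 * ENNReal.ofReal (1 / (1 - Module.finrank ℝ E / p)) * (μ (Metric.ball (0 : E) 1) ^ (1 / p))⁻¹

theorem morreyConst_ne_top [MeasurableSpace E] (μ : Measure E) [μ.IsOpenPosMeasure]
    {p : ℝ} (hp : 0 ≤ p) : morreyConst μ p ≠ ∞ := by
  have h0 : μ (Metric.ball (0 : E) 1) ≠ 0 := (Metric.measure_ball_pos μ _ one_pos).ne'
  have : μ (Metric.ball (0 : E) 1) ^ (1 / p) ≠ 0 := by
    simp [ENNReal.rpow_eq_zero_iff, h0, hp.not_gt]
  exact ENNReal.mul_ne_top (ENNReal.mul_ne_top (by simp) ENNReal.ofReal_ne_top)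
    (ENNReal.inv_ne_top.2 this)

variable [FiniteDimensional ℝ E] [MeasurableSpace E] [BorelSpace E] (μ : Measure E)
  [μ.IsAddHaarMeasure]

/-- Bound the increment by the derivative along the segment from `x` to `z`, swap the integrals, and
for fixed `t` apply the dilation bound in `z`. Integrating `t^(-d/p)` over `(0, 1]` gives the factor
`1/(1 - d/p)`. -/
theorem setLIntegral_enorm_sub_le {f : E → ℝ} (hf : ContDiff ℝ 1 f) {p : ℝ} (hp1 : 1 ≤ p)
    (hp : (Module.finrank ℝ E : ℝ) < p) {x y : E} {r : ℝ} (hxy : x ∈ Metric.closedBall y r) :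
    ∫⁻ z in Metric.closedBall y r, ‖f z - f x‖ₑ ∂μ
      ≤ ENNReal.ofReal (2 * r) * (ENNReal.ofReal (1 / (1 - Module.finrank ℝ E / p)) *
        (eLpNorm (fderiv ℝ f) (ENNReal.ofReal p) μ *
          μ (Metric.closedBall y r) ^ (1 - 1 / p))) := by
  have hp0 : 0 < p := by linarith
  have hcont : Continuous (fderiv ℝ f) := hf.continuous_fderiv one_ne_zero
  have ha : -1 < -(Module.finrank ℝ E : ℝ) / p := by
    rw [neg_div, neg_lt_neg_iff, div_lt_one hp0]
    exact hp
  set B := Metric.closedBall y r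
  calc ∫⁻ z in B, ‖f z - f x‖ₑ ∂μ
      ≤ ∫⁻ z in B, ENNReal.ofReal (2 * r) *
          (∫⁻ t in Set.Ioc (0 : ℝ) 1, ‖fderiv ℝ f (x + t • (z - x))‖ₑ) ∂μ := by
        refine setLIntegral_mono_ae' measurableSet_closedBall (ae_of_all _ fun z hz => ?_)
        refine (enorm_sub_le_lintegral_fderiv hf x z).trans ?_
        gcongr
        rw [← ofReal_norm, ← dist_eq_norm]
        gcongr
        calc dist z x ≤ dist z y + dist x y := dist_triangle_right z x y
          _ ≤ 2 * r := by
            have h1 := Metric.mem_closedBall.1 hz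
            have h2 := Metric.mem_closedBall.1 hxy
            linarith
    _ = ENNReal.ofReal (2 * r) * ∫⁻ t in Set.Ioc (0 : ℝ) 1,
          ∫⁻ z in B, ‖fderiv ℝ f (x + t • (z - x))‖ₑ ∂μ := by
        rw [lintegral_const_mul' _ _ ENNReal.ofReal_ne_top, lintegral_lintegral_swap]
        apply Measurable.aemeasurable
        apply Continuous.measurable
        simp only [Function.uncurry_def]
        fun_prop
    _ ≤ ENNReal.ofReal (2 * r) * ∫⁻ t in Set.Ioc (0 : ℝ) 1,
          ENNReal.ofReal (t ^ (-(Module.finrank ℝ E : ℝ) / p)) *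
            (eLpNorm (fderiv ℝ f) (ENNReal.ofReal p) μ * μ B ^ (1 - 1 / p)) := by
        gcongr ENNReal.ofReal (2 * r) * ?_
        exact setLIntegral_mono_ae' measurableSet_Ioc (ae_of_all _ fun t ht =>
          setLIntegral_comp_homothety_le μ _ hcont hp1 B x ht.1)
    _ = _ := by
        rw [lintegral_mul_const, setLIntegral_rpow_Ioc_zero_one ha]
        · congr 4
          ring
        · fun_prop

/-- **Morrey's inequality**: the oscillation between a point of a ball and its centre is
controlled by the `L^p` norm of the derivative, for `p` larger than the dimension. -/
theorem enorm_sub_center_le_morrey {f : E → ℝ} (hf : ContDiff ℝ 1 f) {p : ℝ} (hp1 : 1 ≤ p)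
    (hp : (Module.finrank ℝ E : ℝ) < p) {x y : E} {r : ℝ} (hr : 0 < r)
    (hxy : x ∈ Metric.closedBall y r) :
    ‖f x - f y‖ₑ ≤ morreyConst μ p * ENNReal.ofReal (r ^ (1 - Module.finrank ℝ E / p)) *
      eLpNorm (fderiv ℝ f) (ENNReal.ofReal p) μ := by
  have hp0 : 0 < p := by linarith
  have hyy : y ∈ Metric.closedBall y r := Metric.mem_closedBall_self hr.le
  have hx := setLIntegral_enorm_sub_le μ hf hp1 hp hxy
  have hy := setLIntegral_enorm_sub_le μ hf hp1 hp hyy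
  have hB := Measure.addHaar_closedBall μ y hr.le
  set B := Metric.closedBall y r
  set b := μ (Metric.ball (0 : E) 1)
  set d := Module.finrank ℝ E
  set L := eLpNorm (fderiv ℝ f) (ENNReal.ofReal p) μ
  set k := ENNReal.ofReal (1 / (1 - d / p))
  have hb0 : b ≠ 0 := (Metric.measure_ball_pos μ _ one_pos).ne'
  have hbt : b ≠ ∞ := measure_ball_lt_top.ne
  have hB0 : μ B ≠ 0 := (Metric.measure_closedBall_pos μ _ hr).ne'
  have hBt : μ B ≠ ∞ := measure_closedBall_lt_top.ne
  -- Compare `f x` and `f y` through `f z`, averaged over `z ∈ B`; the 4 is two integrals, each with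
  -- factor `2 * r`.
  have key : ‖f x - f y‖ₑ * μ B ≤ (4 * ENNReal.ofReal r * k * L * μ B ^ (-(1 / p))) * μ B := by
    calc ‖f x - f y‖ₑ * μ B = ∫⁻ _ in B, ‖f x - f y‖ₑ ∂μ := by simp
      _ ≤ ∫⁻ z in B, (‖f z - f x‖ₑ + ‖f z - f y‖ₑ) ∂μ := by
        refine lintegral_mono fun z => ?_
        have h : f x - f y = (f z - f y) - (f z - f x) := by ring
        rw [h, add_comm]
        exact enorm_sub_le
      _ = ∫⁻ z in B, ‖f z - f x‖ₑ ∂μ + ∫⁻ z in B, ‖f z - f y‖ₑ ∂μ := by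
        have := hf.continuous
        exact lintegral_add_left (by fun_prop) _
      _ ≤ _ := add_le_add hx hy
      _ = (4 * ENNReal.ofReal r * k * L) * μ B ^ (1 - 1 / p) := by
        rw [ENNReal.ofReal_mul zero_le_two, ENNReal.ofReal_ofNat]
        ring
      _ = _ := by
        have h : (1 - 1 / p) = -(1 / p) + 1 := by ring
        rw [h, ENNReal.rpow_add _ _ hB0 hBt, ENNReal.rpow_one]
        ring
  rw [ENNReal.mul_le_mul_iff_left hB0 hBt] at key
  refine key.trans_eq ?_
  have hr' : r ^ d ≠ 0 := by positivity
  rw [ENNReal.rpow_neg, hB, ENNReal.mul_rpow_of_nonneg _ _ (by positivity),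
    ENNReal.mul_inv (Or.inl (by positivity)) (Or.inr (by positivity)),
    ENNReal.ofReal_rpow_of_pos (by positivity), ← ENNReal.ofReal_inv_of_pos (by positivity)]
  have h : ENNReal.ofReal (r ^ (1 - d / p)) =
      ENNReal.ofReal r * ENNReal.ofReal (((r ^ d) ^ (1 / p))⁻¹) := by
    rw [← ENNReal.ofReal_mul hr.le]
    congr 1
    rw [← Real.rpow_natCast, ← Real.rpow_mul hr.le, ← Real.rpow_neg hr.le, Real.rpow_sub hr,
      Real.rpow_one, Real.rpow_neg hr.le, div_eq_mul_inv, mul_one_div]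
  rw [h, morreyConst]
  ring

end Morrey

/-! ### Sup bound on `W_0^{1,p}` in terms of the inner radius -/

theorem eLpNorm_gradient {E : Type*} [NormedAddCommGroup E] [InnerProductSpace ℝ E]
    [CompleteSpace E] [MeasurableSpace E] (μ : Measure E) (f : E → ℝ) (p : ℝ≥0∞) :
    eLpNorm (gradient f) p μ = eLpNorm (fderiv ℝ f) p μ :=
  eLpNorm_congr_norm_ae (ae_of_all _ fun x => by simp [gradient])

theorem support_gradient_subset {E : Type*} [NormedAddCommGroup E] [InnerProductSpace ℝ E]
    [CompleteSpace E] (f : E → ℝ) : Function.support (gradient f) ⊆ tsupport f := by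
  intro x hx
  refine tsupport_fderiv_subset ℝ (subset_tsupport _ ?_)
  rw [Function.mem_support] at hx ⊢
  intro h
  exact hx (by simp [gradient, h])

theorem exists_notMem_dist_le_innerRadius {N : ℕ} {Ω : Opens (EuclideanSpace ℝ (Fin N))}
    (hΩ : innerRadius Ω ≠ ∞) {x : EuclideanSpace ℝ (Fin N)} (hx : x ∈ Ω) :
    ∃ y ∉ Ω, 0 < (innerRadius Ω).toReal ∧ dist x y ≤ (innerRadius Ω).toReal := by
  have hle : Metric.infEDist x (Ω : Set (EuclideanSpace ℝ (Fin N)))ᶜ ≤ innerRadius Ω :=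
    le_iSup₂_of_le x hx le_rfl
  have hne : ((Ω : Set (EuclideanSpace ℝ (Fin N)))ᶜ).Nonempty := by
    rw [Set.nonempty_iff_ne_empty]
    intro h
    rw [h, Metric.infEDist_empty] at hle
    exact hΩ (top_le_iff.1 hle)
  obtain ⟨y, hy, hd⟩ := Ω.isOpen.isClosed_compl.exists_infDist_eq_dist hne x
  have hdist : dist x y ≤ (innerRadius Ω).toReal := by
    rw [← hd]
    exact ENNReal.toReal_mono hΩ hle
  have hxy : x ≠ y := fun h => hy (h ▸ hx)
  exact ⟨y, hy, (dist_pos.2 hxy).trans_le hdist, hdist⟩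

/-- Morrey on the ball of radius `r_Ω` centred at a nearest point of the complement, where `φ`
vanishes. The ball may leave `Ω`, since `φ` is smooth on the whole space. -/
theorem enorm_testFunction_le {N : ℕ} {p : ℝ} (hp1 : 1 ≤ p) (hp : (N : ℝ) < p)
    {Ω : Opens (EuclideanSpace ℝ (Fin N))} (hΩ : innerRadius Ω ≠ ∞) (φ : 𝓓(Ω, ℝ))
    {x : EuclideanSpace ℝ (Fin N)} (hx : x ∈ Ω) :
    ‖φ x‖ₑ ≤ morreyConst (volume : Measure (EuclideanSpace ℝ (Fin N))) p *
      innerRadius Ω ^ (1 - N / p) *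
      eLpNorm (gradient φ) (ENNReal.ofReal p) (volume.restrict Ω) := by
  obtain ⟨y, hy, hr, hd⟩ := exists_notMem_dist_le_innerRadius hΩ hx
  have hφy : φ y = 0 := image_eq_zero_of_notMem_tsupport fun h => hy (φ.tsupport_subset h)
  have hφ : ContDiff ℝ 1 φ := φ.contDiff.of_le (by simp)
  have h := enorm_sub_center_le_morrey (volume : Measure (EuclideanSpace ℝ (Fin N))) hφ hp1
    (by simpa using hp) hr (Metric.mem_closedBall.2 hd)
  rw [hφy, sub_zero, finrank_euclideanSpace_fin, ← ENNReal.ofReal_rpow_of_pos hr,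
    ENNReal.ofReal_toReal hΩ, ← eLpNorm_gradient] at h
  rwa [eLpNorm_restrict_eq_of_support_subset
    ((support_gradient_subset _).trans φ.tsupport_subset)]

theorem MemW1p₀.ae_enorm_le {N : ℕ} {p : ℝ} (hp1 : 1 ≤ p) (hp : (N : ℝ) < p)
    {Ω : Opens (EuclideanSpace ℝ (Fin N))} (hΩ : innerRadius Ω ≠ ∞)
    {u : EuclideanSpace ℝ (Fin N) → ℝ} {G : EuclideanSpace ℝ (Fin N) → EuclideanSpace ℝ (Fin N)}
    (hu : MemW1p₀ Ω p u G) :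
    ∀ᵐ x ∂(volume.restrict (Ω : Set (EuclideanSpace ℝ (Fin N)))),
      ‖u x‖ₑ ≤ morreyConst (volume : Measure (EuclideanSpace ℝ (Fin N))) p *
        innerRadius Ω ^ (1 - N / p) * eLpNorm G (ENNReal.ofReal p) (volume.restrict Ω) := by
  have hp0 : 0 < p := by linarith
  obtain ⟨φ, hφu, hφG⟩ := hu.exists_approx
  set M := morreyConst (volume : Measure (EuclideanSpace ℝ (Fin N))) p *
    innerRadius Ω ^ (1 - N / p) with hM
  have hMt : M ≠ ∞ := by
    refine ENNReal.mul_ne_top (morreyConst_ne_top _ hp0.le)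
      (ENNReal.rpow_ne_top_of_nonneg ?_ hΩ)
    rw [sub_nonneg, div_le_one hp0]
    exact hp.le
  -- A subsequence converges almost everywhere, so the pointwise bound passes to the limit.
  obtain ⟨ns, hns, hae⟩ := (tendstoInMeasure_of_tendsto_eLpNorm (by simpa using hp0)
    (fun n => (φ n).continuous.aestronglyMeasurable)
    hu.memW1p.memLp_fun.aestronglyMeasurable hφu).exists_seq_tendsto_ae
  have hcont : ∀ n, Continuous (gradient (φ n)) := fun n =>
    (InnerProductSpace.toDual ℝ _).symm.continuous.comp
      (((φ n).contDiff.of_le (by simp) : ContDiff ℝ 1 (φ n)).continuous_fderiv one_ne_zero)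
  have hbound : ∀ n, eLpNorm (gradient (φ n)) (ENNReal.ofReal p) (volume.restrict Ω) ≤
      eLpNorm (fun x => gradient (φ n) x - G x) (ENNReal.ofReal p) (volume.restrict Ω) +
        eLpNorm G (ENNReal.ofReal p) (volume.restrict Ω) := fun n => by
    have h := eLpNorm_add_le (μ := volume.restrict (Ω : Set (EuclideanSpace ℝ (Fin N))))
      (f := fun x => gradient (φ n) x - G x) (g := G) (p := ENNReal.ofReal p)
      ((hcont n).aestronglyMeasurable.sub hu.memW1p.memLp_grad.aestronglyMeasurable)
      hu.memW1p.memLp_grad.aestronglyMeasurable (ENNReal.one_le_ofReal.2 hp1)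
    refine le_trans (le_of_eq ?_) h
    congr 1
    ext1 x
    simp
  have hlim : Tendsto (fun n => M * (eLpNorm (fun x => gradient (φ n) x - G x) (ENNReal.ofReal p)
      (volume.restrict Ω) + eLpNorm G (ENNReal.ofReal p) (volume.restrict Ω))) atTop
      (𝓝 (M * eLpNorm G (ENNReal.ofReal p) (volume.restrict Ω))) := by
    refine ENNReal.Tendsto.const_mul ?_ (Or.inr hMt)
    simpa using hφG.add_const (eLpNorm G (ENNReal.ofReal p) (volume.restrict Ω))
  filter_upwards [hae, ae_restrict_mem Ω.isOpen.measurableSet] with x hx hxΩ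
  refine le_of_tendsto_of_tendsto' hx.enorm (hlim.comp hns.tendsto_atTop) fun n => ?_
  refine (enorm_testFunction_le hp1 hp hΩ (φ (ns n)) hxΩ).trans ?_
  exact mul_le_mul' le_rfl (hbound (ns n))

/-! ### Energy identity and conclusion -/

theorem enorm_abs_rpow_sub_two_mul_mul_self (a : ℝ) {p : ℝ} (hp : 0 < p) :
    ‖|a| ^ (p - 2) * a * a‖ₑ = ‖a‖ₑ ^ p := by
  have h : |a| ^ (p - 2) * a * a = |a| ^ p := by
    -- The exponent `p - 2` need not be positive, so exponents are added only for `a ≠ 0`.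
    rcases eq_or_ne a 0 with rfl | ha
    · simp [Real.zero_rpow hp.ne']
    · rw [mul_assoc, ← abs_mul_abs_self a, ← sq, ← Real.rpow_natCast |a| 2,
        ← Real.rpow_add (abs_pos.2 ha)]
      congr 1
      norm_num
  rw [h, Real.enorm_rpow_of_nonneg (abs_nonneg a) hp.le, Real.enorm_abs]

theorem ofReal_integral_norm_rpow_sub_two_mul_inner_self {E α : Type*} [NormedAddCommGroup E]
    [InnerProductSpace ℝ E] [MeasurableSpace α] {μ : Measure α} {G : α → E} {p : ℝ} (hp : 0 < p)
    (hG : MemLp G (ENNReal.ofReal p) μ) :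
    ENNReal.ofReal (∫ x, ‖G x‖ ^ (p - 2) * inner ℝ (G x) (G x) ∂μ) =
      eLpNorm G (ENNReal.ofReal p) μ ^ p := by
  have hp0 : ENNReal.ofReal p ≠ 0 := by simpa using hp
  have h : ∀ x, ‖G x‖ ^ (p - 2) * inner ℝ (G x) (G x) = ‖G x‖ ^ p := fun x => by
    rw [real_inner_self_eq_norm_sq]
    rcases eq_or_ne (G x) 0 with h0 | h0
    · simp [h0, Real.zero_rpow hp.ne']
    · rw [← Real.rpow_natCast, ← Real.rpow_add (norm_pos_iff.2 h0)]
      congr 1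
      norm_num
  have hint := hG.integrable_norm_rpow hp0 ENNReal.ofReal_ne_top
  rw [ENNReal.toReal_ofReal hp.le] at hint
  simp_rw [h]
  rw [ofReal_integral_eq_lintegral_ofReal hint (ae_of_all _ fun x => by positivity),
    eLpNorm_eq_lintegral_rpow_enorm_toReal hp0 ENNReal.ofReal_ne_top,
    ENNReal.toReal_ofReal hp.le, ← ENNReal.rpow_mul, one_div_mul_cancel hp.ne', ENNReal.rpow_one]
  refine lintegral_congr fun x => ?_
  rw [← ENNReal.ofReal_rpow_of_nonneg (norm_nonneg _) hp.le, ofReal_norm]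

/-- Testing the equation with the solution itself. -/
theorem IsWeakSolution.one_le {N : ℕ} {p : ℝ} (hp1 : 1 ≤ p) (hp : (N : ℝ) < p)
    {Ω : Opens (EuclideanSpace ℝ (Fin N))} (hΩ : innerRadius Ω ≠ ∞)
    {w u : EuclideanSpace ℝ (Fin N) → ℝ} (hu : IsWeakSolution Ω p w u)
    (hu0 : ¬ u =ᵐ[volume.restrict Ω] 0) :
    1 ≤ eLpNorm w 1 (volume.restrict Ω) *
      (morreyConst (volume : Measure (EuclideanSpace ℝ (Fin N))) p ^ p *
        innerRadius Ω ^ (p - N)) := by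
  have hp0 : 0 < p := by linarith
  obtain ⟨G, hG, htest⟩ := hu
  have hsup := hG.ae_enorm_le hp1 hp hΩ
  have henergy := ofReal_integral_norm_rpow_sub_two_mul_inner_self hp0 hG.memW1p.memLp_grad
  rw [htest u G hG] at henergy
  have hAt := hG.memW1p.memLp_grad.eLpNorm_ne_top
  set A := eLpNorm G (ENNReal.ofReal p) (volume.restrict Ω)
  -- A vanishing gradient would force `u = 0` a.e. by the sup bound.
  have hA0 : A ≠ 0 := by
    intro h
    rw [h, mul_zero] at hsup
    refine hu0 ?_
    filter_upwards [hsup] with x hx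
    simpa using hx
  set k := morreyConst (volume : Measure (EuclideanSpace ℝ (Fin N))) p
  set R := innerRadius Ω
  have hk : k ≠ ∞ := morreyConst_ne_top _ hp0.le
  have hpow : (k * R ^ (1 - N / p) * A) ^ p = k ^ p * R ^ (p - N) * A ^ p := by
    rw [ENNReal.mul_rpow_of_nonneg _ _ hp0.le, ENNReal.mul_rpow_of_nonneg _ _ hp0.le,
      ← ENNReal.rpow_mul]
    congr 4
    field_simp
  have hle : 1 * A ^ p ≤ eLpNorm w 1 (volume.restrict Ω) * (k ^ p * R ^ (p - N)) * A ^ p := by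
    rw [one_mul, mul_assoc, ← hpow, ← henergy, eLpNorm_one_eq_lintegral_enorm,
      ← lintegral_mul_const' _ _ (ENNReal.rpow_ne_top_of_nonneg hp0.le ?_)]
    · refine (Real.ofReal_le_enorm _).trans ((enorm_integral_le_lintegral_enorm _).trans ?_)
      refine lintegral_mono_ae ?_
      filter_upwards [hsup] with x hx
      rw [enorm_mul, enorm_abs_rpow_sub_two_mul_mul_self _ hp0]
      gcongr
    · refine ENNReal.mul_ne_top (ENNReal.mul_ne_top hk (ENNReal.rpow_ne_top_of_nonneg ?_ hΩ)) hAt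
      rw [sub_nonneg, div_le_one hp0]
      exact hp.le
  rwa [ENNReal.mul_le_mul_iff_left] at hle
  · simp [ENNReal.rpow_eq_zero_iff, hA0, hp0.not_gt]
  · exact ENNReal.rpow_ne_top_of_nonneg hp0.le hAt

theorem theorem2p1 (N : ℕ) (hN : 1 ≤ N) (p : ℝ) (hp : (N : ℝ) < p) :
    ∃ C : ℝ, 0 < C ∧
      ∀ (Ω : Opens (EuclideanSpace ℝ (Fin N))) (w u : EuclideanSpace ℝ (Fin N) → ℝ),
        MemLp w 1 (volume.restrict Ω) →
        (∀ᵐ x ∂(volume.restrict Ω), 0 ≤ w x) →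
        IsWeakSolution Ω p w u →
        (¬ u =ᵐ[volume.restrict Ω] 0) →
        ENNReal.ofReal C / innerRadius Ω ^ (p - N) ≤ eLpNorm w 1 (volume.restrict Ω) := by
  have hp1 : 1 ≤ p := by
    have : (1 : ℝ) ≤ N := by exact_mod_cast hN
    linarith
  have hp0 : 0 < p := by linarith
  set k := morreyConst (volume : Measure (EuclideanSpace ℝ (Fin N))) p with hk
  have hkt : k ≠ ∞ := morreyConst_ne_top _ hp0.le
  -- The `+ 1` makes the constant positive without showing `k ≠ 0`.
  refine ⟨((k.toReal + 1) ^ p)⁻¹, by positivity, fun Ω w u _ _ hu hu0 => ?_⟩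
  by_cases hΩ : innerRadius Ω = ∞
  · rw [hΩ, ENNReal.top_rpow_of_pos (sub_pos.2 hp), ENNReal.div_top]
    exact zero_le
  have hmain := hu.one_le hp1 hp hΩ hu0
  rw [← hk] at hmain
  refine ENNReal.div_le_of_le_mul ?_
  have hC : ENNReal.ofReal ((k.toReal + 1) ^ p)⁻¹ * k ^ p ≤ 1 := by
    rw [← ENNReal.ofReal_toReal (ENNReal.rpow_ne_top_of_nonneg hp0.le hkt),
      ← ENNReal.toReal_rpow, ← ENNReal.ofReal_mul (by positivity), ENNReal.ofReal_le_one,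
      inv_mul_le_one₀ (by positivity)]
    gcongr
    linarith
  calc ENNReal.ofReal ((k.toReal + 1) ^ p)⁻¹
      ≤ ENNReal.ofReal ((k.toReal + 1) ^ p)⁻¹ *
          (eLpNorm w 1 (volume.restrict Ω) * (k ^ p * innerRadius Ω ^ (p - N))) :=
        le_mul_of_one_le_right' hmain
    _ = ENNReal.ofReal ((k.toReal + 1) ^ p)⁻¹ * k ^ p *
          (eLpNorm w 1 (volume.restrict Ω) * innerRadius Ω ^ (p - N)) := by ring
    _ ≤ 1 * (eLpNorm w 1 (volume.restrict Ω) * innerRadius Ω ^ (p - N)) := by gcongr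
    _ = _ := one_mul _
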